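/- Let $d\ge 3$ and $s>1+\frac d2$. For $x=(x',x_d)\in\mathbb R^d$ with $x'\in\mathbb R^{d-1}$, put $r=|x'|$, $z=x_d$, $e_r=(x'/|x'|,0)$ and $e_z=(0,\dots,0,1)$. Let $u\in H^s(\mathbb R^d;\mathbb R^d)$ be divergence free, in the sense that $\xi\cdot\hat u(\xi)=0$ for almost every $\xi\in\mathbb R^d$, and identify $u$ with its continuous representative. Suppose that $u$ is axisymmetric and swirl-free, that is, \[ u(x)=u_r(r,z)\,e_r+u_z(r,z)\,e_z , \] which on the axis $x'=0$ is read as $u(0,z)=u_z(0,z)\,e_z$, and let $\omega=\partial_r u_z-\partial_z u_r$ be its scalar vorticity, for $r>0$ and $z\in\mathbb R$. Suppose that $\omega$ is odd in $z$, i.e. $\omega(r,-z)=-\omega(r,z)$ for all $r>0$, $z\in\mathbb R$; that $\omega(r,z)\ge 0$ for all $r,z>0$; and that $\omega$ is not identically zero. Then \[ u_z(0,z)<0\quad\text{for all } z>0, \qquad\text{and}\qquad u_r(r,0)>0\quad\text{for all } r>0 . \] -/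

import Mathlib

open MeasureTheory
open scoped FourierTransform SchwartzMap

noncomputable section

namespace AxisymFlow

/-! Throughout, `d = n + 1` and `ℝᵈ = EuclideanSpace ℝ (Fin (n + 1))`, with points written
`x = (x', x_d)`, where `x' = (x 0, …, x (n - 1))` and `x_d` is the last coordinate. -/

/-- The unit vector `e_z = e_d`. -/
def eZ (n : ℕ) : EuclideanSpace ℝ (Fin (n + 1)) :=
  EuclideanSpace.single (Fin.last n) 1

/-- The height `z = x_d`. -/
def zCoord {n : ℕ} (x : EuclideanSpace ℝ (Fin (n + 1))) : ℝ :=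
  x (Fin.last n)

/-- The distance to the axis, `r = |x'|`. -/
def rCoord {n : ℕ} (x : EuclideanSpace ℝ (Fin (n + 1))) : ℝ :=
  Real.sqrt (∑ i : Fin n, x i.castSucc ^ 2)

/-- The radial unit vector `e_r = (x' / |x'|, 0)`; on the axis `x' = 0` this expression is `0`. -/
def eR {n : ℕ} (x : EuclideanSpace ℝ (Fin (n + 1))) : EuclideanSpace ℝ (Fin (n + 1)) :=
  (rCoord x)⁻¹ • (x - zCoord x • eZ n)

/-- `u` is axisymmetric and swirl-free with components `ur`, `uz`:
`u(x) = ur(r, z) e_r + uz(r, z) e_z`. On the axis this reads `u(x) = uz(0, z) e_z`. -/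
def IsAxisymSwirlFree {n : ℕ}
    (u : EuclideanSpace ℝ (Fin (n + 1)) → EuclideanSpace ℝ (Fin (n + 1)))
    (ur uz : ℝ → ℝ → ℝ) : Prop :=
  ∀ x, u x = ur (rCoord x) (zCoord x) • eR x + uz (rCoord x) (zCoord x) • eZ n

/-- The scalar vorticity `ω = ∂_r u_z - ∂_z u_r`, used for `r > 0`. -/
def scalarVorticity (ur uz : ℝ → ℝ → ℝ) (r z : ℝ) : ℝ :=
  deriv (fun ρ => uz ρ z) r - deriv (fun ζ => ur r ζ) z

/-- A real vector field on `ℝᵈ` regarded as a `ℂᵈ`-valued one (to take its Fourier transform). -/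
def complexify {n : ℕ}
    (u : EuclideanSpace ℝ (Fin (n + 1)) → EuclideanSpace ℝ (Fin (n + 1))) :
    EuclideanSpace ℝ (Fin (n + 1)) → EuclideanSpace ℂ (Fin (n + 1)) :=
  fun x => WithLp.toLp 2 (fun j => ((u x j : ℝ) : ℂ))

/-- `u ∈ H^s_df(ℝᵈ)` (for `s ≥ 0`): `u` is square-integrable, `(1 + |ξ|²)^(s/2) û` is
square-integrable, and `u` is divergence free in the sense that `ξ · û(ξ) = 0` for almost
every `ξ`. -/
def MemHsDivFree {n : ℕ} (s : ℝ)
    (u : EuclideanSpace ℝ (Fin (n + 1)) → EuclideanSpace ℝ (Fin (n + 1))) : Prop :=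
  ∃ hu : MemLp (complexify u) 2 volume,
    TemperedDistribution.MemSobolev s 2
      (hu.toLp (complexify u) :
        𝓢'(EuclideanSpace ℝ (Fin (n + 1)), EuclideanSpace ℂ (Fin (n + 1)))) ∧
    ∀ᵐ ξ : EuclideanSpace ℝ (Fin (n + 1)),
      ∑ j, (ξ j : ℂ) * (𝓕 (hu.toLp (complexify u)) :
        Lp (EuclideanSpace ℂ (Fin (n + 1))) 2
          (volume : Measure (EuclideanSpace ℝ (Fin (n + 1))))) ξ j = 0

end AxisymFlow

end

/-! Write `ω_ij = ∂_i u_j - ∂_j u_i`. Since `div u = 0`, `Δu_j = Σ_i ∂_i ω_ij`, so `u` is recovered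
from its vorticity by the Biot–Savart law. To avoid the singular kernel, it is replaced by `K_i(y) =
(y - p)_i q^(-d/2)` with `q = |y - p|² + ε²`. The field `K` has symmetric gradient and divergence `d
ε² q^(-d/2-1)`, a multiple of an approximate identity at `p`. Integration by parts needs only `L²`
bounds and gives `Σ_i ∫ K_i ω_ij = -∫ (div K) u_j`, which tends to `-m u_j(p)` with `m > 0` as `ε →
0` (`mollified_biotSavart`, `tendsto_integral_mollifier`).

For an axisymmetric swirl-free field the only nonzero entries are `ω_id = (y_i / r) ω`, `i < d`, and
their negatives. With `p = z₀ e_z` and `j = d` the left side is the integral of `W q^(-d/2)` with `W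
= r ω`. With `p = r₀ e_1` and `j = 1` it is minus such an integral, with `W = z ω y_1 / r`. In both
cases `p = t e_k` with `t > 0`, and `W` is odd in `y_k` and nonnegative where `y_k > 0`, so both
claims follow from `pos_of_tendsto_integral_odd`.

That lemma folds the integral across `y_k = 0`: twice the integral is that of `W (q_t^(-a) -
q_{-t}^(-a))`, where `q_{±t}` is centred at `±t e_k`. This integrand is nonnegative and grows as `ε`
decreases, so the limit is at least half the strictly positive value at `ε = 1`; the singular
integral itself is never needed.

The analytic input is that `s > 1 + d/2` makes `(1 + |ξ|) û` integrable, so `u` is bounded and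
differentiable, with continuous derivatives in `L²` (`regularity_of_memHsDivFree`). -/

noncomputable section

namespace AxisymFlow

/-! ### Sobolev regularity through Fourier inversion. -/

section FourierRegularity

variable {E F : Type*} [NormedAddCommGroup E] [InnerProductSpace ℝ E] [FiniteDimensional ℝ E]
  [MeasurableSpace E] [BorelSpace E] [NormedAddCommGroup F] [InnerProductSpace ℂ F]
  [CompleteSpace F]

omit [CompleteSpace F] in
theorem continuous_fourierInv {h : E → F} (hi : Integrable h) : Continuous (𝓕⁻ h) := by
  refine VectorFourier.fourierIntegral_continuous Real.continuous_fourierChar ?_ hi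
  change Continuous fun p : E × E => (-innerₗ E) p.1 p.2
  simp only [LinearMap.neg_apply, innerₗ_apply_apply]
  fun_prop

omit [CompleteSpace F] in
theorem norm_fourierInv_le {h : E → F} (x : E) : ‖𝓕⁻ h x‖ ≤ ∫ ξ, ‖h ξ‖ :=
  VectorFourier.norm_fourierIntegral_le_integral_norm _ _ _ _ _

theorem integral_fourierInv_smul_eq {g : E → ℂ} {h : E → F} (hg : Integrable g)
    (hh : Integrable h) : ∫ x, 𝓕⁻ g x • h x = ∫ x, g x • 𝓕⁻ h x := by
  have key := VectorFourier.integral_fourierIntegral_smul_eq_flip (L := -innerₗ E)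
    (μ := (volume : Measure E)) (ν := (volume : Measure E)) (f := g) (g := h)
    Real.continuous_fourierChar
    (by simp only [LinearMap.neg_apply, innerₗ_apply_apply]; fun_prop) hg hh
  have hflip : (-innerₗ E).flip = -innerₗ E := by
    ext x y
    simp [real_inner_comm]
  rw [hflip] at key
  exact key

/-- The `L²` inverse Fourier transform of an integrable function is the usual one. -/
theorem Lp_fourierInv_ae_eq (h : Lp F 2 (volume : Measure E)) (hi : Integrable h) :
    ((𝓕⁻ h : Lp F 2 (volume : Measure E)) : E → F) =ᵐ[volume] 𝓕⁻ (h : E → F) := by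
  apply ae_eq_of_integral_contDiff_smul_eq
  · exact (Lp.memLp _).locallyIntegrable (by norm_num)
  · exact (continuous_fourierInv hi).locallyIntegrable
  intro g g_smooth g_cpt
  have hg₁ : HasCompactSupport (Complex.ofRealCLM ∘ g) := g_cpt.comp_left rfl
  have hg₂ : ContDiff ℝ (↑(⊤ : ℕ∞)) (Complex.ofRealCLM ∘ g) := by fun_prop
  set φ : 𝓢(E, ℂ) := hg₁.toSchwartzMap hg₂ with hφ
  have hφg : ∀ x, φ x = (g x : ℂ) := fun x => by simp [hφ]
  -- The `L²` inverse transform agrees with the distributional one, whose pairing with `φ` puts `𝓕⁻`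
  -- on `φ`; integrability of `h` then allows moving it back onto `h` by Fubini.
  have h1 := congrArg (fun T : 𝓢'(E, F) => T φ) (Lp.fourierInv_toTemperedDistribution_eq h)
  simp only [TemperedDistribution.fourierInv_apply, Lp.toTemperedDistribution_apply] at h1
  have h2 := integral_fourierInv_smul_eq (φ.integrable (μ := volume)) hi
  rw [SchwartzMap.fourierInv_coe, h2] at h1
  simpa [hφg] using h1.symm

omit [CompleteSpace F] in
theorem hasFDerivAt_fourierInv {V : E → F} (h0 : Integrable V)
    (h1 : Integrable fun ξ => ‖ξ‖ * ‖V ξ‖) (x m : E) :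
    DifferentiableAt ℝ (𝓕⁻ V) x ∧
    fderiv ℝ (𝓕⁻ V) x m =
      𝓕⁻ (fun ξ => (2 * Real.pi * Complex.I * (inner ℝ ξ m : ℝ) : ℂ) • V ξ) x := by
  have e : 𝓕⁻ V = (𝓕 V) ∘ (fun x => -x) := by
    ext x; simp [Real.fourierInv_eq_fourier_neg]
  have hd := Real.hasFDerivAt_fourier h0 h1 (-x)
  have hc : HasFDerivAt (𝓕⁻ V) ((𝓕 (VectorFourier.fourierSMulRight (innerSL ℝ) V) (-x)).comp
      (-ContinuousLinearMap.id ℝ E)) x := by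
    rw [e]
    exact hd.comp x (hasFDerivAt_id x).neg
  refine ⟨hc.differentiableAt, ?_⟩
  rw [hc.fderiv]
  have hint : Integrable (VectorFourier.fourierSMulRight (innerSL ℝ) V) := by
    refine (h1.const_mul (2 * Real.pi * ‖innerSL ℝ (E := E)‖)).mono'
      h0.aestronglyMeasurable.fourierSMulRight (Filter.Eventually.of_forall fun ξ => ?_)
    have := VectorFourier.norm_fourierSMulRight_le (innerSL ℝ) V ξ
    linarith
  rw [ContinuousLinearMap.comp_apply, Real.fourier_continuousLinearMap_apply hint,
    Real.fourierInv_eq_fourier_neg]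
  refine congrArg (fun G : E → F => 𝓕 G (-x)) (funext fun ξ => ?_)
  have hin : innerSL ℝ ξ (-m) = -inner ℝ ξ m := by simp
  simp only [neg_apply, ContinuousLinearMap.id_apply, VectorFourier.fourierSMulRight_apply, hin,
    ← Complex.coe_smul, smul_smul]
  push_cast
  ring_nf

/-- The transform is `(1 + |ξ|²)^(-s/2) f` with `f ∈ L²`. One power of `|ξ|` costs at most the
weight `(1 + |ξ|²)^((1-s)/2)`, which is square-integrable because `2 (s - 1) > d`; Cauchy–Schwarz
gives the `L¹` bounds, and boundedness of the weight gives the `L²` bound. -/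
theorem exists_fourierInv_rep {s : ℝ} (hs : 1 + (Module.finrank ℝ E : ℝ) / 2 < s)
    (U : Lp F 2 (volume : Measure E))
    (hU : TemperedDistribution.MemSobolev s 2 (U : 𝓢'(E, F))) :
    Integrable (𝓕 U : Lp F 2 (volume : Measure E)) ∧
    Integrable (fun ξ => ‖ξ‖ * ‖(𝓕 U : Lp F 2 (volume : Measure E)) ξ‖) ∧
    MemLp (fun ξ => ‖ξ‖ * ‖(𝓕 U : Lp F 2 (volume : Measure E)) ξ‖) 2 volume := by
  obtain ⟨f, hf⟩ := TemperedDistribution.memSobolev_iff_exists_smulLeftCLM_fourier.mp hU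
  rw [Lp.fourier_toTemperedDistribution_eq] at hf
  set V : Lp F 2 (volume : Measure E) := 𝓕 U
  set w : E → ℝ := fun ξ => (1 + ‖ξ‖ ^ 2) ^ (-s / 2) with hw
  have hwc : Continuous w := by
    refine Continuous.rpow_const (by fun_prop) fun ξ => Or.inl (by positivity)
  have hwT : (fun ξ => (w ξ : ℂ)).HasTemperateGrowth := by
    simp only [hw]
    fun_prop
  have hwle : ∀ ξ, ‖(w ξ : ℂ)‖ ≤ 1 := fun ξ => by
    rw [Complex.norm_real, Real.norm_eq_abs, abs_of_nonneg (by positivity)]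
    refine Real.rpow_le_one_of_one_le_of_nonpos (by nlinarith [norm_nonneg ξ]) ?_
    have : (0:ℝ) ≤ Module.finrank ℝ E := by positivity
    linarith
  have hwm : MemLp (fun ξ => (w ξ : ℂ)) ⊤ (volume : Measure E) :=
    memLp_top_of_bound (by fun_prop) 1 (Filter.Eventually.of_forall hwle)
  -- The identity is first obtained for tempered distributions, by multiplying with the inverse
  -- weight, and descends to `L²` by injectivity of the embedding.
  have hVf : V = (hwm.toLp _ • f : Lp F 2 (volume : Measure E)) := by
    have hk := Lp.toTemperedDistribution_smul_eq (r := 2) hwT hwm f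
    rw [← hf, TemperedDistribution.smulLeftCLM_smulLeftCLM_apply (by fun_prop) hwT] at hk
    have h1 : ((fun x : E => (((1 + ‖x‖ ^ 2) ^ (s / 2) : ℝ) : ℂ)) * fun ξ => (w ξ : ℂ))
        = fun _ => 1 := by
      ext x
      rw [Pi.mul_apply, ← Complex.ofReal_mul, hw, ← Real.rpow_add (by positivity)]
      ring_nf
      simp
    rw [h1, TemperedDistribution.smulLeftCLM_const, one_smul] at hk
    have hinj := LinearMap.ker_eq_bot.mp
      (Lp.ker_toTemperedDistributionCLM_eq_bot (F := F) (μ := (volume : Measure E)) (p := 2))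
    exact (hinj hk).symm
  have hae : ∀ᵐ ξ, ‖V ξ‖ = w ξ * ‖f ξ‖ := by
    rw [hVf]
    filter_upwards [Lp.coeFn_lpSMul (r := 2) (hwm.toLp _) f, hwm.coeFn_toLp] with x hg hg'
    rw [hg, Pi.smul_apply', hg', norm_smul, Complex.norm_real, Real.norm_eq_abs,
      abs_of_nonneg (by positivity)]
  set w₁ : E → ℝ := fun ξ => (1 + ‖ξ‖ ^ 2) ^ ((1 - s) / 2) with hw₁
  have hw₁c : Continuous w₁ :=
    Continuous.rpow_const (by fun_prop) fun ξ => Or.inl (by positivity)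
  have hpos : ∀ ξ : E, 1 ≤ 1 + ‖ξ‖ ^ 2 := fun ξ => by nlinarith [norm_nonneg ξ]
  have hww₁ : ∀ ξ, w₁ ξ = w ξ * Real.sqrt (1 + ‖ξ‖ ^ 2) := fun ξ => by
    rw [Real.sqrt_eq_rpow, hw₁, hw, ← Real.rpow_add (by positivity)]
    ring_nf
  have hw0 : ∀ ξ, 0 ≤ w ξ := fun ξ => by positivity
  have hle1 : ∀ ξ, w ξ ≤ w₁ ξ := fun ξ => by
    rw [hww₁]
    exact le_mul_of_one_le_right (hw0 ξ) (Real.one_le_sqrt.mpr (hpos ξ))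
  have hle2 : ∀ ξ, ‖ξ‖ * w ξ ≤ w₁ ξ := fun ξ => by
    rw [hww₁, mul_comm]
    exact mul_le_mul_of_nonneg_left (Real.le_sqrt_of_sq_le (by linarith)) (hw0 ξ)
  have hle3 : ∀ ξ, w₁ ξ ≤ 1 := fun ξ => by
    refine Real.rpow_le_one_of_one_le_of_nonpos (hpos ξ) ?_
    have : (0:ℝ) ≤ Module.finrank ℝ E := by positivity
    linarith
  have hw₁2 : MemLp w₁ 2 (volume : Measure E) := by
    rw [memLp_two_iff_integrable_sq hw₁c.aestronglyMeasurable]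
    refine (integrable_rpow_neg_one_add_norm_sq (E := E) (μ := volume) (r := 2 * (s - 1))
      (by linarith)).congr (Filter.Eventually.of_forall fun ξ => ?_)
    simp only [hw₁]
    rw [← Real.rpow_mul_natCast (by positivity)]
    congr 1
    push_cast
    ring
  have hf2 : MemLp (fun ξ => ‖f ξ‖) 2 (volume : Measure E) := (Lp.memLp f).norm
  have hg : Integrable (fun ξ => w₁ ξ * ‖f ξ‖) (volume : Measure E) := hw₁2.integrable_mul hf2
  have hVm : AEStronglyMeasurable V (volume : Measure E) := Lp.aestronglyMeasurable V
  have hVm' : AEStronglyMeasurable (fun ξ => ‖ξ‖ * ‖V ξ‖) (volume : Measure E) :=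
    continuous_norm.aestronglyMeasurable.mul hVm.norm
  refine ⟨hg.mono' hVm ?_, hg.mono' hVm' ?_, hf2.mono hVm' ?_⟩
  · filter_upwards [hae] with ξ hξ
    rw [hξ]
    exact mul_le_mul_of_nonneg_right (hle1 ξ) (norm_nonneg _)
  · filter_upwards [hae] with ξ hξ
    rw [hξ, Real.norm_eq_abs, abs_of_nonneg (by have := hw0 ξ; positivity), ← mul_assoc]
    exact mul_le_mul_of_nonneg_right (hle2 ξ) (norm_nonneg _)
  · filter_upwards [hae] with ξ hξ
    rw [hξ, Real.norm_eq_abs, abs_of_nonneg (by have := hw0 ξ; positivity), ← mul_assoc,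
      norm_norm]
    exact mul_le_of_le_one_left (norm_nonneg _) ((hle2 ξ).trans (hle3 ξ))

/-- A continuous function of class `H^s`, `s > 1 + d / 2`, is bounded and differentiable, and its
directional derivatives are continuous, square-integrable and given by Fourier inversion. -/
theorem regularity_of_memSobolev {s : ℝ} (hs : 1 + (Module.finrank ℝ E : ℝ) / 2 < s)
    {f : E → F} (hc : Continuous f) (hf : MemLp f 2 (volume : Measure E))
    (hS : TemperedDistribution.MemSobolev s 2 (hf.toLp f : 𝓢'(E, F))) :
    (∃ C, ∀ x, ‖f x‖ ≤ C) ∧ Differentiable ℝ f ∧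
    (∀ m, Continuous fun x => fderiv ℝ f x m) ∧
    (∀ m, MemLp (fun x => fderiv ℝ f x m) 2 (volume : Measure E)) ∧
    (∀ x m, Integrable (fun ξ => (2 * Real.pi * Complex.I * (inner ℝ ξ m : ℝ) : ℂ) •
        (𝓕 (hf.toLp f) : Lp F 2 (volume : Measure E)) ξ) ∧ fderiv ℝ f x m =
      𝓕⁻ (fun ξ => (2 * Real.pi * Complex.I * (inner ℝ ξ m : ℝ) : ℂ) •
        (𝓕 (hf.toLp f) : Lp F 2 (volume : Measure E)) ξ) x) := by
  obtain ⟨h0, h1, h2⟩ := exists_fourierInv_rep hs _ hS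
  set V : Lp F 2 (volume : Measure E) := 𝓕 (hf.toLp f) with hV
  -- Both sides are continuous, so almost everywhere equality upgrades to equality at every point.
  have hfV : f = 𝓕⁻ (V : E → F) := by
    refine (Continuous.ae_eq_iff_eq volume hc (continuous_fourierInv h0)).mp ?_
    have h := Lp_fourierInv_ae_eq V h0
    rw [hV, FourierTransform.fourierInv_fourier_eq, ← hV] at h
    exact hf.coeFn_toLp.symm.trans h
  have hbound : ∀ m ξ : E, ‖(2 * Real.pi * Complex.I * (inner ℝ ξ m : ℝ) : ℂ) • V ξ‖ ≤
      ‖(2 * Real.pi * ‖m‖) * (‖ξ‖ * ‖V ξ‖)‖ := fun m ξ => by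
    have := norm_inner_le_norm (𝕜 := ℝ) ξ m
    rw [norm_smul, norm_mul, norm_mul, norm_mul, Complex.norm_I, Complex.norm_real,
      Complex.norm_real, Complex.norm_ofNat, Real.norm_of_nonneg Real.pi_pos.le,
      Real.norm_of_nonneg (by positivity : 0 ≤ 2 * Real.pi * ‖m‖ * (‖ξ‖ * ‖V ξ‖))]
    calc 2 * Real.pi * 1 * ‖inner ℝ ξ m‖ * ‖V ξ‖ ≤ 2 * Real.pi * 1 * (‖ξ‖ * ‖m‖) * ‖V ξ‖ := by
          gcongr
      _ = _ := by ring
  have hmeas : ∀ m : E, AEStronglyMeasurable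
      (fun ξ => (2 * Real.pi * Complex.I * (inner ℝ ξ m : ℝ) : ℂ) • V ξ) volume := fun m =>
    (Continuous.aestronglyMeasurable (by fun_prop)).smul (Lp.aestronglyMeasurable V)
  have hint : ∀ m : E, Integrable
      (fun ξ => (2 * Real.pi * Complex.I * (inner ℝ ξ m : ℝ) : ℂ) • V ξ) volume := fun m =>
    (h1.const_mul _).mono (hmeas m) (Filter.Eventually.of_forall (hbound m))
  have hL2 : ∀ m : E, MemLp
      (fun ξ => (2 * Real.pi * Complex.I * (inner ℝ ξ m : ℝ) : ℂ) • V ξ) 2 volume := fun m =>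
    (h2.const_mul _).mono (hmeas m) (Filter.Eventually.of_forall (hbound m))
  have hder : ∀ x m, fderiv ℝ f x m =
      𝓕⁻ (fun ξ => (2 * Real.pi * Complex.I * (inner ℝ ξ m : ℝ) : ℂ) • V ξ) x := fun x m => by
    conv_lhs => rw [hfV]
    exact (hasFDerivAt_fourierInv h0 h1 x m).2
  refine ⟨⟨∫ ξ, ‖V ξ‖, fun x => ?_⟩, fun x => ?_, fun m => ?_, fun m => ?_,
    fun x m => ⟨hint m, hder x m⟩⟩
  · rw [hfV]
    exact norm_fourierInv_le x
  · rw [hfV]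
    exact (hasFDerivAt_fourierInv h0 h1 x 0).1
  · simp only [hder]
    exact continuous_fourierInv (hint m)
  · simp only [hder]
    have h3 : Integrable ((hL2 m).toLp _ : E → F) := (hint m).congr (hL2 m).coeFn_toLp.symm
    refine (Lp.memLp (𝓕⁻ ((hL2 m).toLp _) : Lp F 2 (volume : Measure E))).ae_eq ?_
    refine (Lp_fourierInv_ae_eq _ h3).trans (Filter.Eventually.of_forall fun x => ?_)
    exact Real.fourierInv_congr_ae (hL2 m).coeFn_toLp x

end FourierRegularity

/-! ### Regularity and pointwise incompressibility of the velocity. -/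

section VelocityRegularity

variable {n : ℕ}

/-- The pointwise divergence is the inverse transform of `2πi ξ · û(ξ)`, which vanishes almost
everywhere. The remaining claims are real parts of the complex regularity result, taken
coordinatewise. -/
theorem regularity_of_memHsDivFree {s : ℝ} (hs : 1 + ((n + 1 : ℕ) : ℝ) / 2 < s)
    {u : EuclideanSpace ℝ (Fin (n + 1)) → EuclideanSpace ℝ (Fin (n + 1))}
    (hcont : Continuous u) (hu : MemHsDivFree s u) :
    (∃ C, ∀ j x, |u x j| ≤ C) ∧ Differentiable ℝ u ∧
    (∀ j, MemLp (fun x => u x j) 2 volume) ∧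
    (∀ j m, Continuous fun x => fderiv ℝ (fun y => u y j) x m) ∧
    (∀ j m, MemLp (fun x => fderiv ℝ (fun y => u y j) x m) 2 volume) ∧
    (∀ x, ∑ j, fderiv ℝ (fun y => u y j) x (EuclideanSpace.single j 1) = 0) := by
  obtain ⟨hf, hS, hdiv⟩ := hu
  have hcc : Continuous (complexify u) := by
    unfold complexify
    fun_prop
  obtain ⟨⟨C, hC⟩, hd, hc, hL, hF⟩ := regularity_of_memSobolev (by simpa using hs) hcc hf hS
  set re : Fin (n + 1) → EuclideanSpace ℂ (Fin (n + 1)) →L[ℝ] ℝ := fun j =>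
    Complex.reCLM.comp
      ((EuclideanSpace.proj j : EuclideanSpace ℂ (Fin (n + 1)) →L[ℂ] ℂ).restrictScalars ℝ)
    with hre
  have hur : ∀ j, (fun y => u y j) = fun y => re j (complexify u y) := fun j => by
    ext y; simp [hre, complexify]
  have hder : ∀ j x m, fderiv ℝ (fun y => u y j) x m = re j (fderiv ℝ (complexify u) x m) := by
    intro j x m
    rw [hur j]
    exact congrArg (· m) ((re j).hasFDerivAt.comp x (hd x).hasFDerivAt).fderiv
  have hrele : ∀ j v, |re j v| ≤ ‖v‖ := fun j v => by
    simp only [hre]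
    exact (Complex.abs_re_le_norm _).trans (PiLp.norm_apply_le v j)
  refine ⟨⟨C, fun j x => ?_⟩, ?_, fun j => ?_, fun j m => ?_, fun j m => ?_, fun x => ?_⟩
  · rw [show u x j = re j (complexify u x) from congrFun (hur j) x]
    exact (hrele _ _).trans (hC x)
  · rw [differentiable_euclidean]
    intro j
    rw [hur j]
    exact (re j).differentiable.comp hd
  · rw [hur j]
    exact (re j).comp_memLp' hf
  · simp only [hder]
    exact (re j).continuous.comp (hc m)
  · simp only [hder]
    exact (re j).comp_memLp' (hL m)
  · set P : Fin (n + 1) → EuclideanSpace ℂ (Fin (n + 1)) →L[ℂ] ℂ := fun j => EuclideanSpace.proj j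
    set V : Lp (EuclideanSpace ℂ (Fin (n + 1))) 2
      (volume : Measure (EuclideanSpace ℝ (Fin (n + 1)))) := 𝓕 (hf.toLp (complexify u))
    have hconv : ∀ h : EuclideanSpace ℝ (Fin (n + 1)) → EuclideanSpace ℂ (Fin (n + 1)),
        Integrable h → Integrable (fun ξ => Real.fourierChar (inner ℝ ξ x) • h ξ) := fun h hh => by
      simpa using (Real.fourierIntegral_convergent_iff (f := h) (-x)).2 hh
    have key : ∀ j, P j (fderiv ℝ (complexify u) x (EuclideanSpace.single j 1)) =
        ∫ ξ, P j (Real.fourierChar (inner ℝ ξ x) •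
          ((2 * Real.pi * Complex.I * (ξ j : ℝ) : ℂ) • V ξ)) := by
      intro j
      obtain ⟨hi, he⟩ := hF x (EuclideanSpace.single j 1)
      rw [he, Real.fourierInv_eq, ← ContinuousLinearMap.integral_comp_comm _ (hconv _ hi)]
      simp [EuclideanSpace.inner_single_right]
    have hint : ∀ j, Integrable (fun ξ => P j (Real.fourierChar (inner ℝ ξ x) •
          ((2 * Real.pi * Complex.I * (ξ j : ℝ) : ℂ) • V ξ))) := fun j => by
      have := (P j).integrable_comp (hconv _ (hF x (EuclideanSpace.single j 1)).1)
      simpa [EuclideanSpace.inner_single_right] using this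
    have hsum : ∑ j, P j (fderiv ℝ (complexify u) x (EuclideanSpace.single j 1)) = 0 := by
      simp only [key]
      rw [← integral_finsetSum _ fun j _ => hint j]
      rw [← integral_zero (EuclideanSpace ℝ (Fin (n + 1))) ℂ (μ := volume)]
      refine integral_congr_ae (hdiv.mono fun ξ hξ => ?_)
      have : ∀ j, P j (Real.fourierChar (inner ℝ ξ x) •
          ((2 * Real.pi * Complex.I * (ξ j : ℝ) : ℂ) • V ξ)) =
          ((Real.fourierChar (inner ℝ ξ x) : ℂ) * (2 * Real.pi * Complex.I)) * (ξ j * V ξ j) := by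
        intro j
        have hP : ∀ v, P j v = v j := fun _ => rfl
        simp only [hP, Circle.smul_def, PiLp.smul_apply, smul_eq_mul]
        ring
      simp only [this]
      rw [← Finset.mul_sum, hξ, mul_zero]
    simp only [hder]
    have := congrArg Complex.re hsum
    simpa [P, hre] using this

end VelocityRegularity

/-! ### The mollified Biot–Savart law. -/

section MollifiedKernel

variable {d : ℕ}

/-- `∂ᵢ uⱼ - ∂ⱼ uᵢ`. -/
def vorticityEntry (u : EuclideanSpace ℝ (Fin d) → EuclideanSpace ℝ (Fin d))
    (i j : Fin d) (y : EuclideanSpace ℝ (Fin d)) : ℝ :=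
  fderiv ℝ (fun x => u x j) y (EuclideanSpace.single i 1) -
    fderiv ℝ (fun x => u x i) y (EuclideanSpace.single j 1)

/-- The regularized squared distance `|y - p|² + ε²`. -/
def regDistSq (p : EuclideanSpace ℝ (Fin d)) (ε : ℝ) (y : EuclideanSpace ℝ (Fin d)) : ℝ :=
  ‖y - p‖ ^ 2 + ε ^ 2

theorem regDistSq_pos (p : EuclideanSpace ℝ (Fin d)) {ε : ℝ} (hε : 0 < ε)
    (y : EuclideanSpace ℝ (Fin d)) : 0 < regDistSq p ε y := by
  unfold regDistSq; positivity

theorem continuous_regDistSq_rpow (p : EuclideanSpace ℝ (Fin d)) {ε : ℝ} (hε : 0 < ε) (a : ℝ) :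
    Continuous fun y => regDistSq p ε y ^ a := by
  refine Continuous.rpow_const ?_ fun y => Or.inl (regDistSq_pos p hε y).ne'
  unfold regDistSq
  fun_prop

theorem memLp_regDistSq_rpow (p : EuclideanSpace ℝ (Fin d)) {ε : ℝ} (hε : 0 < ε) {a : ℝ}
    (ha : (d : ℝ) < 4 * a) : MemLp (fun y => regDistSq p ε y ^ (-a)) 2 volume := by
  have ha0 : 0 < a := by
    have : (0 : ℝ) ≤ d := by positivity
    linarith
  have h1 : MemLp (fun y : EuclideanSpace ℝ (Fin d) => (1 + ‖y‖ ^ 2) ^ (-a)) 2 volume := by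
    rw [memLp_two_iff_integrable_sq (Continuous.aestronglyMeasurable
      (Continuous.rpow_const (by fun_prop) fun y => Or.inl (by positivity)))]
    refine (integrable_rpow_neg_one_add_norm_sq (E := EuclideanSpace ℝ (Fin d)) (μ := volume)
      (r := 4 * a) (by simpa using ha)).congr (Filter.Eventually.of_forall fun y => ?_)
    simp only
    rw [← Real.rpow_mul_natCast (by positivity)]
    congr 1
    push_cast
    ring
  have h2 := h1.comp_measurePreserving (measurePreserving_sub_right volume p)
  -- With this `c`, `c (1 + |y - p|²) ≤ |y - p|² + ε²`, which compares with the translated weight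
  -- `(1 + |y|²)^(-a)`.
  set c := min 1 (ε ^ 2) with hc
  have hc0 : 0 < c := by positivity
  refine (h2.const_mul (c ^ (-a))).mono
    (continuous_regDistSq_rpow p hε _).aestronglyMeasurable
    (Filter.Eventually.of_forall fun y => ?_)
  have hle : c * (1 + ‖y - p‖ ^ 2) ≤ regDistSq p ε y := by
    unfold regDistSq
    have := min_le_left 1 (ε ^ 2)
    have := min_le_right 1 (ε ^ 2)
    nlinarith [sq_nonneg ‖y - p‖]
  have hq := regDistSq_pos p hε y
  rw [Real.norm_of_nonneg (by positivity),
    Real.norm_of_nonneg (by simp only [Function.comp]; positivity)]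
  simp only [Function.comp]
  rw [← Real.mul_rpow hc0.le (by positivity)]
  exact Real.rpow_le_rpow_of_nonpos (by positivity) hle (by linarith)

theorem abs_coord_le (p : EuclideanSpace ℝ (Fin d)) {ε : ℝ} (hε : 0 < ε)
    (y : EuclideanSpace ℝ (Fin d)) (i : Fin d) :
    |(y - p) i| ≤ regDistSq p ε y ^ (1 / 2 : ℝ) := by
  rw [← Real.sqrt_eq_rpow]
  refine Real.le_sqrt_of_sq_le ?_
  have h : |(y - p) i| ≤ ‖y - p‖ := PiLp.norm_apply_le (y - p) i
  unfold regDistSq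
  nlinarith [abs_nonneg ((y - p) i), sq_nonneg ε]

/-- The gradient of the mollified Newtonian potential, up to a constant. -/
def biotSavartKernel (p : EuclideanSpace ℝ (Fin d)) (ε : ℝ) (i : Fin d)
    (y : EuclideanSpace ℝ (Fin d)) : ℝ :=
  (y - p) i * regDistSq p ε y ^ (-(d : ℝ) / 2)

/-- The partial derivatives of `biotSavartKernel`. -/
def biotSavartKernelDeriv (p : EuclideanSpace ℝ (Fin d)) (ε : ℝ) (i k : Fin d)
    (y : EuclideanSpace ℝ (Fin d)) : ℝ :=
  (if i = k then 1 else 0) * regDistSq p ε y ^ (-(d : ℝ) / 2) -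
    d * ((y - p) i * (y - p) k * regDistSq p ε y ^ (-(d : ℝ) / 2 - 1))

theorem biotSavartKernelDeriv_comm (p : EuclideanSpace ℝ (Fin d)) (ε : ℝ) (i k : Fin d)
    (y : EuclideanSpace ℝ (Fin d)) :
    biotSavartKernelDeriv p ε i k y = biotSavartKernelDeriv p ε k i y := by
  simp only [biotSavartKernelDeriv, eq_comm (a := i), mul_comm ((y - p) i)]

/-- Writing `q^(-d/2) = q · q^(-d/2-1)`, the divergence has the factor `d (q - |y - p|²) = d ε²`.
What remains is the mollifier that replaces the Dirac mass. -/
theorem sum_biotSavartKernelDeriv (p : EuclideanSpace ℝ (Fin d)) {ε : ℝ} (hε : 0 < ε)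
    (y : EuclideanSpace ℝ (Fin d)) :
    ∑ i, biotSavartKernelDeriv p ε i i y =
      d * ε ^ 2 * regDistSq p ε y ^ (-(d : ℝ) / 2 - 1) := by
  have hq := regDistSq_pos p hε y
  have h1 : regDistSq p ε y ^ (-(d : ℝ) / 2) =
      regDistSq p ε y * regDistSq p ε y ^ (-(d : ℝ) / 2 - 1) := by
    rw [Real.rpow_sub_one hq.ne']
    field_simp
  have h2 : ∑ i, (y - p) i * (y - p) i = ‖y - p‖ ^ 2 := by
    rw [EuclideanSpace.real_norm_sq_eq]
    simp [sq]
  simp only [biotSavartKernelDeriv, if_true, one_mul, Finset.sum_sub_distrib, ← Finset.mul_sum,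
    ← Finset.sum_mul, h2, Finset.sum_const, Finset.card_univ, Fintype.card_fin, nsmul_eq_mul]
  rw [h1]
  unfold regDistSq
  ring

theorem hasFDerivAt_regDistSq (p : EuclideanSpace ℝ (Fin d)) (ε : ℝ)
    (y : EuclideanSpace ℝ (Fin d)) :
    HasFDerivAt (regDistSq p ε) ((2 : ℝ) • innerSL ℝ (y - p)) y := by
  have h := (((hasFDerivAt_id y).sub_const p).norm_sq).add_const (ε ^ 2)
  refine h.congr_fderiv ?_
  ext v
  simp

theorem fderiv_biotSavartKernel (p : EuclideanSpace ℝ (Fin d)) {ε : ℝ} (hε : 0 < ε) (i k : Fin d)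
    (y : EuclideanSpace ℝ (Fin d)) :
    DifferentiableAt ℝ (biotSavartKernel p ε i) y ∧
    fderiv ℝ (biotSavartKernel p ε i) y (EuclideanSpace.single k 1) =
      biotSavartKernelDeriv p ε i k y := by
  have h1 : HasFDerivAt (fun y : EuclideanSpace ℝ (Fin d) => (y - p) i)
      (EuclideanSpace.proj i : EuclideanSpace ℝ (Fin d) →L[ℝ] ℝ) y :=
    (EuclideanSpace.proj i : EuclideanSpace ℝ (Fin d) →L[ℝ] ℝ).hasFDerivAt.comp y
      ((hasFDerivAt_id y).sub_const p)
  have h2 := (hasFDerivAt_regDistSq p ε y).rpow_const (p := -(d : ℝ) / 2)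
    (Or.inl (regDistSq_pos p hε y).ne')
  have h := h1.mul h2
  refine ⟨h.differentiableAt, ?_⟩
  have := congrArg (fun A => A (EuclideanSpace.single k (1 : ℝ))) h.fderiv
  refine Eq.trans this ?_
  simp [biotSavartKernelDeriv, EuclideanSpace.inner_single_right]
  ring

/-- Here dimension at least three is essential: the kernel decays like `|y|^(1-d)`, which is
square-integrable at infinity only if `2 (d - 1) > d`. -/
theorem memLp_biotSavartKernel (hd : 3 ≤ d) (p : EuclideanSpace ℝ (Fin d)) {ε : ℝ} (hε : 0 < ε)
    (i : Fin d) : MemLp (biotSavartKernel p ε i) 2 volume := by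
  have hd' : (3 : ℝ) ≤ d := by exact_mod_cast hd
  refine (memLp_regDistSq_rpow p hε (a := ((d : ℝ) - 1) / 2) (by linarith)).mono
    (Continuous.aestronglyMeasurable ?_) (Filter.Eventually.of_forall fun y => ?_)
  · exact Continuous.mul (by fun_prop) (continuous_regDistSq_rpow p hε _)
  · have hq := regDistSq_pos p hε y
    rw [biotSavartKernel, norm_mul, Real.norm_of_nonneg (Real.rpow_nonneg hq.le _),
      Real.norm_of_nonneg (Real.rpow_nonneg hq.le _)]
    calc _ ≤ regDistSq p ε y ^ (1 / 2 : ℝ) * regDistSq p ε y ^ (-(d : ℝ) / 2) := by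
          gcongr
          exact abs_coord_le p hε y i
      _ = _ := by
          rw [← Real.rpow_add hq]
          ring_nf

theorem memLp_biotSavartKernelDeriv (hd : 3 ≤ d) (p : EuclideanSpace ℝ (Fin d)) {ε : ℝ}
    (hε : 0 < ε) (i k : Fin d) : MemLp (biotSavartKernelDeriv p ε i k) 2 volume := by
  have hd' : (3 : ℝ) ≤ d := by exact_mod_cast hd
  have h0 : MemLp (fun y => regDistSq p ε y ^ (-(d : ℝ) / 2)) 2 volume := by
    have := memLp_regDistSq_rpow p hε (a := (d : ℝ) / 2) (by linarith)
    simpa [neg_div] using this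
  refine (h0.const_mul _).sub (MemLp.const_mul (h0.mono (Continuous.aestronglyMeasurable ?_)
    (Filter.Eventually.of_forall fun y => ?_)) _)
  · exact Continuous.mul (by fun_prop) (continuous_regDistSq_rpow p hε _)
  · have hq := regDistSq_pos p hε y
    rw [norm_mul, norm_mul, Real.norm_of_nonneg (Real.rpow_nonneg hq.le _),
      Real.norm_of_nonneg (Real.rpow_nonneg hq.le _)]
    calc _ ≤ regDistSq p ε y ^ (1 / 2 : ℝ) * regDistSq p ε y ^ (1 / 2 : ℝ) *
            regDistSq p ε y ^ (-(d : ℝ) / 2 - 1) := by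
          gcongr
          · exact abs_coord_le p hε y i
          · exact abs_coord_le p hε y k
      _ = _ := by
          rw [← Real.rpow_add hq, ← Real.rpow_add hq]
          ring_nf

/-- No boundary terms arise: each product involved is integrable as a product of two `L²` functions.
-/
theorem integral_kernel_mul_fderiv (hd : 3 ≤ d) (p : EuclideanSpace ℝ (Fin d)) {ε : ℝ}
    (hε : 0 < ε) (i k : Fin d) {g : EuclideanSpace ℝ (Fin d) → ℝ} (hg : Differentiable ℝ g)
    (hg2 : MemLp g 2 volume)
    (hg'2 : MemLp (fun y => fderiv ℝ g y (EuclideanSpace.single k 1)) 2 volume) :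
    ∫ y, biotSavartKernel p ε i y * fderiv ℝ g y (EuclideanSpace.single k 1) =
      -∫ y, biotSavartKernelDeriv p ε i k y * g y := by
  have h : ∀ y, biotSavartKernelDeriv p ε i k y =
      fderiv ℝ (biotSavartKernel p ε i) y (EuclideanSpace.single k 1) := fun y =>
    (fderiv_biotSavartKernel p hε i k y).2.symm
  simp only [h]
  refine integral_mul_fderiv_eq_neg_fderiv_mul_of_integrable ?_ ?_ ?_
    (fun y _ => (fderiv_biotSavartKernel p hε i k y).1) fun y _ => hg y
  · simp only [← h]
    exact (memLp_biotSavartKernelDeriv hd p hε i k).integrable_mul hg2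
  · exact (memLp_biotSavartKernel hd p hε i).integrable_mul hg'2
  · exact (memLp_biotSavartKernel hd p hε i).integrable_mul hg2

theorem integrable_kernel_mul_vorticityEntry (hd : 3 ≤ d) (p : EuclideanSpace ℝ (Fin d)) {ε : ℝ}
    (hε : 0 < ε) {u : EuclideanSpace ℝ (Fin d) → EuclideanSpace ℝ (Fin d)}
    (hu'2 : ∀ j m, MemLp (fun y => fderiv ℝ (fun x => u x j) y m) 2 volume) (i j : Fin d) :
    Integrable (fun y => biotSavartKernel p ε i y * vorticityEntry u i j y) :=
  (memLp_biotSavartKernel hd p hε i).integrable_mul ((hu'2 j _).sub (hu'2 i _))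

/-- The mollified Biot–Savart law. -/
theorem mollified_biotSavart (hd : 3 ≤ d) (p : EuclideanSpace ℝ (Fin d)) {ε : ℝ} (hε : 0 < ε)
    {u : EuclideanSpace ℝ (Fin d) → EuclideanSpace ℝ (Fin d)} (hu : Differentiable ℝ u)
    (hu2 : ∀ j, MemLp (fun y => u y j) 2 volume)
    (hu'2 : ∀ j m, MemLp (fun y => fderiv ℝ (fun x => u x j) y m) 2 volume)
    (hdiv : ∀ y, ∑ j, fderiv ℝ (fun x => u x j) y (EuclideanSpace.single j 1) = 0) (j : Fin d) :
    ∫ y, ∑ i, biotSavartKernel p ε i y * vorticityEntry u i j y =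
      -∫ y, d * ε ^ 2 * regDistSq p ε y ^ (-(d : ℝ) / 2 - 1) * u y j := by
  have hK := memLp_biotSavartKernel hd p hε
  have hK' := memLp_biotSavartKernelDeriv hd p hε
  have huj : ∀ j, Differentiable ℝ fun y => u y j := fun j =>
    differentiable_euclidean.mp hu j
  have hA : ∀ i j k, Integrable (fun y =>
      biotSavartKernel p ε i y * fderiv ℝ (fun x => u x j) y (EuclideanSpace.single k 1)) :=
    fun i j k => (hK i).integrable_mul (hu'2 j _)
  have hB : ∀ i k j, Integrable (fun y => biotSavartKernelDeriv p ε i k y * u y j) :=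
    fun i k j => (hK' i k).integrable_mul (hu2 j)
  have hip : ∀ i k j, ∫ y, biotSavartKernel p ε i y *
      fderiv ℝ (fun x => u x j) y (EuclideanSpace.single k 1) =
      -∫ y, biotSavartKernelDeriv p ε i k y * u y j := fun i k j =>
    integral_kernel_mul_fderiv hd p hε i k (huj j) (hu2 j) (hu'2 j _)
  -- Since `∂_j K_i = ∂_i K_j`, a second integration by parts moves the derivative onto `u_i` as
  -- `∂_i u_i`, and the sum over `i` is the divergence.
  have h0 : ∑ i, ∫ y, biotSavartKernelDeriv p ε i j y * u y i = 0 := by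
    calc ∑ i, ∫ y, biotSavartKernelDeriv p ε i j y * u y i
        = ∑ i, -∫ y, biotSavartKernel p ε j y *
            fderiv ℝ (fun x => u x i) y (EuclideanSpace.single i 1) := by
          refine Finset.sum_congr rfl fun i _ => ?_
          rw [hip j i i, neg_neg]
          simp only [biotSavartKernelDeriv_comm p ε i j]
      _ = -∫ y, ∑ i, biotSavartKernel p ε j y *
            fderiv ℝ (fun x => u x i) y (EuclideanSpace.single i 1) := by
          rw [integral_finsetSum _ fun i _ => hA j i i, Finset.sum_neg_distrib]
      _ = 0 := by simp [← Finset.mul_sum, hdiv]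
  have hAB : ∀ i, Integrable (fun y => biotSavartKernel p ε i y *
        fderiv ℝ (fun x => u x j) y (EuclideanSpace.single i 1) -
      biotSavartKernel p ε i y * fderiv ℝ (fun x => u x i) y (EuclideanSpace.single j 1)) :=
    fun i => (hA i j i).sub (hA i i j)
  simp only [vorticityEntry, mul_sub]
  rw [integral_finsetSum _ fun i _ => hAB i]
  simp_rw [integral_sub (hA _ j _) (hA _ _ j), hip]
  rw [Finset.sum_sub_distrib, Finset.sum_neg_distrib, Finset.sum_neg_distrib, h0, neg_zero,
    sub_zero, ← integral_finsetSum _ fun i _ => hB i i j]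
  simp only [← Finset.sum_mul, sum_biotSavartKernelDeriv p hε]

/-- Substitution `y = p + ε x`: the powers of `ε` cancel as `ε^d · ε² · ε^(-d-2) = 1`, so the total
mass does not depend on `ε`. -/
theorem integral_mollifier_eq (p : EuclideanSpace ℝ (Fin d)) {ε : ℝ} (hε : 0 < ε)
    (g : EuclideanSpace ℝ (Fin d) → ℝ) :
    ∫ y, d * ε ^ 2 * regDistSq p ε y ^ (-(d : ℝ) / 2 - 1) * g y =
      ∫ x, d * (1 + ‖x‖ ^ 2) ^ (-(d : ℝ) / 2 - 1) * g (p + ε • x) := by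
  rw [← integral_add_left_eq_self _ p]
  have h := Measure.integral_comp_smul (volume : Measure (EuclideanSpace ℝ (Fin d)))
    (fun y => d * ε ^ 2 * regDistSq p ε (p + y) ^ (-(d : ℝ) / 2 - 1) * g (p + y)) ε
  rw [finrank_euclideanSpace_fin, abs_of_pos (by positivity), smul_eq_mul,
    eq_inv_mul_iff_mul_eq₀ (by positivity), ← integral_const_mul] at h
  rw [← h]
  refine integral_congr_ae (Filter.Eventually.of_forall fun x => ?_)
  have h1 : regDistSq p ε (p + ε • x) = ε ^ (2 : ℝ) * (1 + ‖x‖ ^ 2) := by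
    simp only [regDistSq, add_sub_cancel_left, norm_smul, Real.norm_of_nonneg hε.le]
    norm_cast
    ring
  have h2 : ε ^ d * (ε ^ 2 * (ε ^ (2 : ℝ)) ^ (-(d : ℝ) / 2 - 1)) = 1 := by
    rw [← Real.rpow_mul hε.le, ← Real.rpow_natCast ε d, ← Real.rpow_natCast ε 2,
      ← Real.rpow_add hε, ← Real.rpow_add hε]
    push_cast
    ring_nf
    simp
  simp only
  rw [h1, Real.mul_rpow (by positivity) (by positivity)]
  linear_combination (d * (1 + ‖x‖ ^ 2) ^ (-(d : ℝ) / 2 - 1) * g (p + ε • x)) * h2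

theorem integrable_mollifier : Integrable fun x : EuclideanSpace ℝ (Fin d) =>
    (d : ℝ) * (1 + ‖x‖ ^ 2) ^ (-(d : ℝ) / 2 - 1) := by
  refine Integrable.const_mul ?_ _
  have := integrable_rpow_neg_one_add_norm_sq (E := EuclideanSpace ℝ (Fin d)) (μ := volume)
    (r := d + 2) (by simp)
  convert this using 3
  ring

theorem integral_mollifier_pos (hd : 0 < d) :
    0 < ∫ x : EuclideanSpace ℝ (Fin d), (d : ℝ) * (1 + ‖x‖ ^ 2) ^ (-(d : ℝ) / 2 - 1) := by
  have hp : ∀ x : EuclideanSpace ℝ (Fin d), 0 < (d : ℝ) * (1 + ‖x‖ ^ 2) ^ (-(d : ℝ) / 2 - 1) :=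
    fun x => by positivity
  rw [integral_pos_iff_support_of_nonneg (fun x => (hp x).le) (integrable_mollifier)]
  rw [Set.eq_univ_of_forall fun x => Function.mem_support.mpr (hp x).ne']
  exact isOpen_univ.measure_pos volume Set.univ_nonempty

theorem tendsto_integral_mollifier (p : EuclideanSpace ℝ (Fin d))
    {g : EuclideanSpace ℝ (Fin d) → ℝ} (hg : Continuous g) {C : ℝ} (hC : ∀ x, |g x| ≤ C) :
    Filter.Tendsto
      (fun ε => ∫ y, d * ε ^ 2 * regDistSq p ε y ^ (-(d : ℝ) / 2 - 1) * g y)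
      (nhdsWithin 0 (Set.Ioi 0))
      (nhds ((∫ x : EuclideanSpace ℝ (Fin d), (d : ℝ) * (1 + ‖x‖ ^ 2) ^ (-(d : ℝ) / 2 - 1)) *
        g p)) := by
  rw [← integral_mul_const]
  have hm : Continuous fun x : EuclideanSpace ℝ (Fin d) =>
      (d : ℝ) * (1 + ‖x‖ ^ 2) ^ (-(d : ℝ) / 2 - 1) :=
    continuous_const.mul (Continuous.rpow_const (by fun_prop) fun x => Or.inl (by positivity))
  have key : Filter.Tendsto
      (fun ε : ℝ => ∫ x, d * (1 + ‖x‖ ^ 2) ^ (-(d : ℝ) / 2 - 1) * g (p + ε • x))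
      (nhdsWithin 0 (Set.Ioi 0))
      (nhds (∫ x : EuclideanSpace ℝ (Fin d), d * (1 + ‖x‖ ^ 2) ^ (-(d : ℝ) / 2 - 1) * g p)) := by
    refine tendsto_integral_filter_of_dominated_convergence
      (fun x => d * (1 + ‖x‖ ^ 2) ^ (-(d : ℝ) / 2 - 1) * C) ?_ ?_
      ((integrable_mollifier).mul_const C) ?_
    · exact Filter.Eventually.of_forall fun ε =>
        (hm.mul (hg.comp (by fun_prop))).aestronglyMeasurable
    · refine Filter.Eventually.of_forall fun ε => Filter.Eventually.of_forall fun x => ?_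
      rw [norm_mul, Real.norm_of_nonneg (by positivity)]
      exact mul_le_mul_of_nonneg_left (hC _) (by positivity)
    · refine Filter.Eventually.of_forall fun x => Filter.Tendsto.mono_left ?_ nhdsWithin_le_nhds
      refine tendsto_const_nhds.mul ?_
      have : Continuous fun ε : ℝ => g (p + ε • x) := hg.comp (by fun_prop)
      simpa using this.tendsto 0
  refine key.congr' ?_
  filter_upwards [self_mem_nhdsWithin] with ε hε
  exact (integral_mollifier_eq p hε g).symm

end MollifiedKernel

/-! ### The vorticity matrix of an axisymmetric swirl-free field. -/

section VorticityStructure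

variable {n : ℕ} {u : EuclideanSpace ℝ (Fin (n + 1)) → EuclideanSpace ℝ (Fin (n + 1))}
  {ur uz : ℝ → ℝ → ℝ}

theorem IsAxisymSwirlFree.apply_last (h : IsAxisymSwirlFree u ur uz)
    (y : EuclideanSpace ℝ (Fin (n + 1))) :
    u y (Fin.last n) = uz (rCoord y) (zCoord y) := by
  simp [h y, eR, eZ, zCoord]

theorem IsAxisymSwirlFree.apply_castSucc (h : IsAxisymSwirlFree u ur uz)
    (y : EuclideanSpace ℝ (Fin (n + 1))) (i : Fin n) :
    u y i.castSucc = ur (rCoord y) (zCoord y) * (rCoord y)⁻¹ * y i.castSucc := by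
  simp [h y, eR, eZ, mul_assoc]

theorem rCoord_nonneg (y : EuclideanSpace ℝ (Fin (n + 1))) : 0 ≤ rCoord y := Real.sqrt_nonneg _

theorem rCoord_sq (y : EuclideanSpace ℝ (Fin (n + 1))) :
    rCoord y ^ 2 = ∑ i : Fin n, y i.castSucc ^ 2 :=
  Real.sq_sqrt (Finset.sum_nonneg fun _ _ => sq_nonneg _)

theorem rCoord_pos_of_ne_zero {y : EuclideanSpace ℝ (Fin (n + 1))} {i : Fin n}
    (h : y i.castSucc ≠ 0) : 0 < rCoord y := by
  refine Real.sqrt_pos.mpr (lt_of_lt_of_le (by positivity : 0 < y i.castSucc ^ 2) ?_)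
  exact Finset.single_le_sum (f := fun i : Fin n => y i.castSucc ^ 2)
    (fun _ _ => sq_nonneg _) (Finset.mem_univ i)

/-- The point with coordinates `r = ρ`, `z = ζ` on the `i`-th horizontal axis. -/
def halfPlanePoint (i : Fin n) (ρ ζ : ℝ) : EuclideanSpace ℝ (Fin (n + 1)) :=
  EuclideanSpace.single i.castSucc ρ + EuclideanSpace.single (Fin.last n) ζ

theorem zCoord_halfPlanePoint (i : Fin n) (ρ ζ : ℝ) : zCoord (halfPlanePoint i ρ ζ) = ζ := by
  simp [zCoord, halfPlanePoint]

theorem rCoord_halfPlanePoint (i : Fin n) {ρ : ℝ} (hρ : 0 ≤ ρ) (ζ : ℝ) :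
    rCoord (halfPlanePoint i ρ ζ) = ρ := by
  simp [rCoord, halfPlanePoint, Real.sqrt_sq hρ]

theorem rCoord_add_single_last (y : EuclideanSpace ℝ (Fin (n + 1))) (t : ℝ) :
    rCoord (y + t • EuclideanSpace.single (Fin.last n) 1) = rCoord y := by
  simp [rCoord]

theorem zCoord_add_single_last (y : EuclideanSpace ℝ (Fin (n + 1))) (t : ℝ) :
    zCoord (y + t • EuclideanSpace.single (Fin.last n) 1) = zCoord y + t := by
  simp [zCoord]

theorem zCoord_add_single_castSucc (y : EuclideanSpace ℝ (Fin (n + 1))) (i : Fin n) (t : ℝ) :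
    zCoord (y + t • EuclideanSpace.single i.castSucc 1) = zCoord y := by
  simp [zCoord]

theorem rCoord_add_single_castSucc (y : EuclideanSpace ℝ (Fin (n + 1))) (i : Fin n) (t : ℝ) :
    rCoord (y + t • EuclideanSpace.single i.castSucc 1) =
      Real.sqrt (rCoord y ^ 2 + (2 * t * y i.castSucc + t ^ 2)) := by
  rw [rCoord_sq, rCoord]
  congr 1
  have h : ∀ k : Fin n, (y + t • EuclideanSpace.single i.castSucc (1 : ℝ)) k.castSucc ^ 2 =
      y k.castSucc ^ 2 + if k = i then 2 * t * y i.castSucc + t ^ 2 else 0 := fun k => by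
    by_cases hk : k = i
    · subst hk; simp; ring
    · simp [hk]
  simp only [h, Finset.sum_add_distrib, Finset.sum_ite_eq', Finset.mem_univ, if_true]

theorem hasDerivAt_rCoord_line {y : EuclideanSpace ℝ (Fin (n + 1))} (hy : 0 < rCoord y)
    (i : Fin n) :
    HasDerivAt (fun t : ℝ => rCoord (y + t • EuclideanSpace.single i.castSucc 1))
      (y i.castSucc / rCoord y) 0 := by
  simp only [rCoord_add_single_castSucc]
  have h1 : HasDerivAt (fun t : ℝ => rCoord y ^ 2 + (2 * t * y i.castSucc + t ^ 2))
      (2 * y i.castSucc) 0 := by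
    have := (((((hasDerivAt_id (0 : ℝ)).const_mul 2).mul_const (y i.castSucc)).add
      ((hasDerivAt_id (0 : ℝ)).pow 2)).const_add (rCoord y ^ 2))
    simpa using this
  have h2 := h1.sqrt (by simp; positivity)
  convert h2 using 1
  simp [Real.sqrt_sq hy.le]
  field_simp

theorem fderiv_eq_of_hasDerivAt_line {d : ℕ} {f : EuclideanSpace ℝ (Fin d) → ℝ}
    {y v : EuclideanSpace ℝ (Fin d)} {f' : ℝ} (hf : DifferentiableAt ℝ f y)
    (h : HasDerivAt (fun t : ℝ => f (y + t • v)) f' 0) : fderiv ℝ f y v = f' := by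
  rw [← hf.lineDeriv_eq_fderiv]
  exact HasLineDerivAt.lineDeriv h

/-- For `r > 0` the components are read off by restricting `u` to the half-plane spanned by a
horizontal axis and `e_z`; hence the need for an index `i`. -/
theorem IsAxisymSwirlFree.differentiableAt_components (h : IsAxisymSwirlFree u ur uz)
    (hu : Differentiable ℝ u) (i : Fin n) {r : ℝ} (hr : 0 < r) (z : ℝ) :
    DifferentiableAt ℝ (fun ρ => uz ρ z) r ∧ DifferentiableAt ℝ (fun ρ => ur ρ z) r ∧
      DifferentiableAt ℝ (fun ζ => ur r ζ) z := by
  have huj := differentiable_euclidean.mp hu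
  have h1 : Differentiable ℝ fun ρ => halfPlanePoint i ρ z := by
    rw [differentiable_euclidean]
    intro j
    simp only [halfPlanePoint, PiLp.add_apply, PiLp.single_apply]
    split_ifs <;> fun_prop
  have h2 : Differentiable ℝ fun ζ => halfPlanePoint i r ζ := by
    rw [differentiable_euclidean]
    intro j
    simp only [halfPlanePoint, PiLp.add_apply, PiLp.single_apply]
    split_ifs <;> fun_prop
  have hur : ∀ ρ ζ, 0 < ρ → u (halfPlanePoint i ρ ζ) i.castSucc = ur ρ ζ := fun ρ ζ hρ => by
    rw [h.apply_castSucc, rCoord_halfPlanePoint i hρ.le, zCoord_halfPlanePoint]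
    have : (halfPlanePoint i ρ ζ) i.castSucc = ρ := by simp [halfPlanePoint]
    rw [this, mul_assoc, inv_mul_cancel₀ hρ.ne', mul_one]
  refine ⟨?_, ?_, ?_⟩
  · refine ((huj (Fin.last n)).comp h1 r).congr_of_eventuallyEq ?_
    filter_upwards [lt_mem_nhds hr] with ρ hρ
    simp [Function.comp, h.apply_last, rCoord_halfPlanePoint i hρ.le, zCoord_halfPlanePoint]
  · refine ((huj i.castSucc).comp h1 r).congr_of_eventuallyEq ?_
    filter_upwards [lt_mem_nhds hr] with ρ hρ
    exact (hur ρ z hρ).symm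
  · refine ((huj i.castSucc).comp h2 z).congr_of_eventuallyEq ?_
    exact Filter.Eventually.of_forall fun ζ => (hur r ζ hr).symm

theorem IsAxisymSwirlFree.vorticityEntry_castSucc_last (h : IsAxisymSwirlFree u ur uz)
    (hu : Differentiable ℝ u) {y : EuclideanSpace ℝ (Fin (n + 1))} (hy : 0 < rCoord y)
    (i : Fin n) : vorticityEntry u i.castSucc (Fin.last n) y =
      y i.castSucc / rCoord y * scalarVorticity ur uz (rCoord y) (zCoord y) := by
  have huj := differentiable_euclidean.mp hu
  obtain ⟨h1, -, h3⟩ := h.differentiableAt_components hu i hy (zCoord y)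
  have e1 : fderiv ℝ (fun x => u x (Fin.last n)) y (EuclideanSpace.single i.castSucc 1) =
      deriv (fun ρ => uz ρ (zCoord y)) (rCoord y) * (y i.castSucc / rCoord y) := by
    refine fderiv_eq_of_hasDerivAt_line (huj _ y) ?_
    simp only [h.apply_last, zCoord_add_single_castSucc]
    exact HasDerivAt.comp_of_eq (h₂ := fun ρ => uz ρ (zCoord y)) 0 h1.hasDerivAt
      (hasDerivAt_rCoord_line hy i) (by simp)
  have e2 : fderiv ℝ (fun x => u x i.castSucc) y (EuclideanSpace.single (Fin.last n) 1) =
      deriv (fun ζ => ur (rCoord y) ζ) (zCoord y) * (rCoord y)⁻¹ * y i.castSucc := by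
    refine fderiv_eq_of_hasDerivAt_line (huj _ y) ?_
    simp only [h.apply_castSucc, zCoord_add_single_last, rCoord_add_single_last]
    have hz : HasDerivAt (fun t : ℝ => ur (rCoord y) (zCoord y + t))
        (deriv (fun ζ => ur (rCoord y) ζ) (zCoord y)) 0 := by
      have := HasDerivAt.comp_of_eq (h₂ := fun ζ => ur (rCoord y) ζ) 0 h3.hasDerivAt
        ((hasDerivAt_id (0 : ℝ)).const_add (zCoord y)) (by simp)
      exact this.congr_deriv (mul_one _)
    simpa using (hz.mul_const (rCoord y)⁻¹).mul_const (y i.castSucc)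
  rw [vorticityEntry, e1, e2, scalarVorticity]
  ring

/-- The horizontal part is `g(r, z) y'` with `g = u_r / r`, so `∂_i u_j = (∂_r g) y_i y_j / r + g
δ_ij` is symmetric in `i` and `j`. -/
theorem IsAxisymSwirlFree.vorticityEntry_castSucc_castSucc (h : IsAxisymSwirlFree u ur uz)
    (hu : Differentiable ℝ u) {y : EuclideanSpace ℝ (Fin (n + 1))} (hy : 0 < rCoord y)
    (i j : Fin n) : vorticityEntry u i.castSucc j.castSucc y = 0 := by
  have huj := differentiable_euclidean.mp hu
  obtain ⟨-, h2, -⟩ := h.differentiableAt_components hu i hy (zCoord y)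
  have key : ∀ i j : Fin n,
      fderiv ℝ (fun x => u x j.castSucc) y (EuclideanSpace.single i.castSucc 1) =
      deriv (fun ρ => ur ρ (zCoord y) * ρ⁻¹) (rCoord y) * (y i.castSucc / rCoord y) *
        y j.castSucc + ur (rCoord y) (zCoord y) * (rCoord y)⁻¹ * (if j = i then 1 else 0) := by
    intro i j
    refine fderiv_eq_of_hasDerivAt_line (huj _ y) ?_
    simp only [h.apply_castSucc, zCoord_add_single_castSucc]
    have hg := HasDerivAt.comp_of_eq (h₂ := fun ρ => ur ρ (zCoord y) * ρ⁻¹) 0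
      (h2.mul (differentiableAt_inv hy.ne')).hasDerivAt (hasDerivAt_rCoord_line hy i) (by simp)
    have hl : HasDerivAt
        (fun t : ℝ => (y + t • EuclideanSpace.single i.castSucc (1 : ℝ)) j.castSucc)
        (if j = i then 1 else 0) 0 := by
      have := ((hasDerivAt_id (0 : ℝ)).mul_const (if j = i then (1 : ℝ) else 0)).const_add
        (y j.castSucc)
      simpa [PiLp.single_apply] using this
    exact (hg.mul hl).congr_deriv (by simp; exact Or.inl (Or.inl rfl))
  rw [vorticityEntry, key, key]
  simp only [eq_comm (a := i)]
  ring

end VorticityStructure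

/-! ### Reflection and positivity of the potential of an odd source. -/

section Positivity

variable {d : ℕ}

/-- The reflection in the hyperplane `y k = 0`. -/
def coordReflection (k : Fin d) :
    EuclideanSpace ℝ (Fin d) ≃ₗᵢ[ℝ] EuclideanSpace ℝ (Fin d) :=
  LinearIsometryEquiv.piLpCongrRight 2 fun i =>
    if i = k then LinearIsometryEquiv.neg ℝ else LinearIsometryEquiv.refl ℝ ℝ

theorem coordReflection_apply (k i : Fin d) (y : EuclideanSpace ℝ (Fin d)) :
    coordReflection k y i = if i = k then -y i else y i := by
  simp only [coordReflection, LinearIsometryEquiv.piLpCongrRight_apply]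
  split_ifs <;> rfl

theorem coordReflection_involutive (k : Fin d) (y : EuclideanSpace ℝ (Fin d)) :
    coordReflection k (coordReflection k y) = y := by
  ext i
  simp only [coordReflection_apply]
  split_ifs <;> simp

theorem regDistSq_coordReflection (k : Fin d) (t ε : ℝ) (y : EuclideanSpace ℝ (Fin d)) :
    regDistSq (EuclideanSpace.single k t) ε (coordReflection k y) =
      regDistSq (EuclideanSpace.single k (-t)) ε y := by
  have : coordReflection k y - EuclideanSpace.single k t =
      coordReflection k (y - EuclideanSpace.single k (-t)) := by
    ext i
    by_cases h : i = k
    · subst h; simp [coordReflection_apply]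
    · simp [coordReflection_apply, h]
  rw [regDistSq, this, LinearIsometryEquiv.norm_map, regDistSq]

/-- The gap `4 t y_k` shows which pole is nearer, and it is independent of `ε`. -/
theorem regDistSq_single_neg (k : Fin d) (t ε : ℝ) (y : EuclideanSpace ℝ (Fin d)) :
    regDistSq (EuclideanSpace.single k (-t)) ε y =
      regDistSq (EuclideanSpace.single k t) ε y + 4 * t * y k := by
  rw [regDistSq, regDistSq, norm_sub_sq_real, norm_sub_sq_real]
  simp [EuclideanSpace.inner_single_right]
  ring

/-- In `Z^(-a) - (Z + c)^(-a) = Z^(-a) (1 - (Z / (Z + c))^a)` both factors are nonnegative and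
nonincreasing in `Z`. This gives monotonicity in `ε`, since raising `ε` shifts both squared
distances by the same `c`. -/
theorem rpow_neg_sub_le {a X Y c : ℝ} (ha : 0 < a) (hX : 0 < X) (hXY : X ≤ Y) (hc : 0 ≤ c) :
    (X + c) ^ (-a) - (Y + c) ^ (-a) ≤ X ^ (-a) - Y ^ (-a) := by
  have hY : 0 < Y := hX.trans_le hXY
  have key : ∀ Z : ℝ, 0 < Z → Z ^ (-a) - (Z + c) ^ (-a) = Z ^ (-a) * (1 - (Z / (Z + c)) ^ a) :=
    fun Z hZ => by
      rw [Real.div_rpow hZ.le (by positivity), Real.rpow_neg hZ.le,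
        Real.rpow_neg (by positivity : 0 ≤ Z + c)]
      have : Z ^ a ≠ 0 := by positivity
      field_simp
  have h1 : Y ^ (-a) ≤ X ^ (-a) := Real.rpow_le_rpow_of_nonpos hX hXY (by linarith)
  have h2 : (X / (X + c)) ^ a ≤ (Y / (Y + c)) ^ a := by
    refine Real.rpow_le_rpow (by positivity) ?_ ha.le
    rw [div_le_div_iff₀ (by positivity) (by positivity)]
    nlinarith
  have h3 : (Y / (Y + c)) ^ a ≤ 1 :=
    Real.rpow_le_one (by positivity) (div_le_one_of_le₀ (by linarith) (by positivity)) ha.le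
  have h4 := mul_le_mul h1 (by linarith : 1 - (Y / (Y + c)) ^ a ≤ 1 - (X / (X + c)) ^ a)
    (by linarith) (by positivity)
  rw [← key X hX, ← key Y hY] at h4
  linarith

theorem dense_coord_ne_zero (k : Fin d) : Dense {y : EuclideanSpace ℝ (Fin d) | y k ≠ 0} := by
  have hs : Function.Surjective (EuclideanSpace.proj k : EuclideanSpace ℝ (Fin d) →L[ℝ] ℝ) :=
    fun t => ⟨EuclideanSpace.single k t, by simp⟩
  exact (dense_compl_singleton (0 : ℝ)).preimage
    ((EuclideanSpace.proj k : EuclideanSpace ℝ (Fin d) →L[ℝ] ℝ).isOpenMap hs)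

/-- A nonzero source which is odd in `y k` and has the sign of `y k` has a positive potential at
`t e_k`, `t > 0`. -/
theorem pos_of_tendsto_integral_odd (k : Fin d) {t a L : ℝ} (ht : 0 < t) (ha : 0 < a)
    {W : EuclideanSpace ℝ (Fin d) → ℝ} (hW : Continuous W)
    (hodd : ∀ y, y k ≠ 0 → W (coordReflection k y) = -W y)
    (hsign : ∀ y, 0 < y k → 0 ≤ W y) (hne : ∃ y, y k ≠ 0 ∧ W y ≠ 0)
    (hint : ∀ ε, 0 < ε →
      Integrable fun y => W y * regDistSq (EuclideanSpace.single k t) ε y ^ (-a))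
    (hlim : Filter.Tendsto
      (fun ε => ∫ y, W y * regDistSq (EuclideanSpace.single k t) ε y ^ (-a))
      (nhdsWithin 0 (Set.Ioi 0)) (nhds L)) : 0 < L := by
  -- Oddness is assumed only off the hyperplane, where the formula for `W` is available in the
  -- applications; density and continuity extend it.
  have hodd' : ∀ y, W (coordReflection k y) = -W y := by
    have := (hW.comp (coordReflection k).continuous).ext_on (dense_coord_ne_zero k) hW.neg
      (fun y hy => hodd y hy)
    exact fun y => congrFun this y
  set G : ℝ → EuclideanSpace ℝ (Fin d) → ℝ := fun ε y =>
    W y * (regDistSq (EuclideanSpace.single k t) ε y ^ (-a) -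
      regDistSq (EuclideanSpace.single k (-t)) ε y ^ (-a)) with hG
  have hRmp := (coordReflection k).measurePreserving
  have hrefl : ∀ ε y, W (coordReflection k y) *
      regDistSq (EuclideanSpace.single k t) ε (coordReflection k y) ^ (-a) =
      -(W y * regDistSq (EuclideanSpace.single k (-t)) ε y ^ (-a)) := fun ε y => by
    rw [hodd', regDistSq_coordReflection, neg_mul]
  have hint' : ∀ ε, 0 < ε →
      Integrable fun y => W y * regDistSq (EuclideanSpace.single k (-t)) ε y ^ (-a) :=
    fun ε hε => by
      have := (hRmp.integrable_comp_of_integrable (hint ε hε)).neg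
      refine this.congr (Filter.Eventually.of_forall fun y => ?_)
      simp [hrefl]
  have hGint : ∀ ε, 0 < ε → Integrable (G ε) := fun ε hε => by
    simp only [hG, mul_sub]
    exact (hint ε hε).sub (hint' ε hε)
  -- Reflecting the variable turns the pole `t e_k` into `-t e_k` and changes the sign of `W`, so
  -- both halves of `G` contribute equally.
  have hGeq : ∀ ε, 0 < ε → ∫ y, G ε y =
      2 * ∫ y, W y * regDistSq (EuclideanSpace.single k t) ε y ^ (-a) := fun ε hε => by
    have h1 := hRmp.integral_comp (coordReflection k).toHomeomorph.measurableEmbedding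
      (fun y => W y * regDistSq (EuclideanSpace.single k t) ε y ^ (-a))
    simp only [hrefl, integral_neg] at h1
    simp only [hG, mul_sub]
    rw [integral_sub (hint ε hε) (hint' ε hε)]
    linarith
  have hGrefl : ∀ ε y, G ε (coordReflection k y) = G ε y := fun ε y => by
    simp only [hG]
    rw [hodd', regDistSq_coordReflection,
      ← regDistSq_coordReflection k t ε (coordReflection k y), coordReflection_involutive]
    ring
  have hreflk : ∀ y, coordReflection k y k = -y k := fun y => by simp [coordReflection_apply]
  -- Passing from `ε` to `1` adds `1 - ε²` to both squared distances. The case `y_k < 0` follows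
  -- from the reflection symmetry of `G`, and on `y_k = 0` both sides vanish.
  have hmono : ∀ ε, 0 < ε → ε ≤ 1 → ∀ y, G 1 y ≤ G ε y := by
    intro ε hε hε1
    have hp : ∀ y, 0 < y k → G 1 y ≤ G ε y := fun y hy => by
      refine mul_le_mul_of_nonneg_left ?_ (hsign y hy)
      have h := rpow_neg_sub_le (c := 1 - ε ^ 2) ha
        (regDistSq_pos (EuclideanSpace.single k t) hε y)
        (Y := regDistSq (EuclideanSpace.single k (-t)) ε y)
        (by rw [regDistSq_single_neg]; nlinarith [mul_pos ht hy]) (by nlinarith)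
      have e : ∀ p, regDistSq p ε y + (1 - ε ^ 2) = regDistSq p 1 y := fun p => by
        unfold regDistSq; ring
      rwa [e, e] at h
    intro y
    rcases lt_trichotomy (y k) 0 with h | h | h
    · rw [← hGrefl 1, ← hGrefl ε]
      exact hp _ (by rw [hreflk]; linarith)
    · simp [hG, regDistSq_single_neg, h]
    · exact hp y h
  have hnonneg : ∀ y, 0 ≤ G 1 y := by
    have hp : ∀ y, 0 < y k → 0 ≤ G 1 y := fun y hy => by
      refine mul_nonneg (hsign y hy) (sub_nonneg.mpr ?_)
      refine Real.rpow_le_rpow_of_nonpos (regDistSq_pos _ one_pos y) ?_ (by linarith)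
      rw [regDistSq_single_neg]; nlinarith [mul_pos ht hy]
    intro y
    rcases lt_trichotomy (y k) 0 with h | h | h
    · rw [← hGrefl 1]
      exact hp _ (by rw [hreflk]; linarith)
    · simp [hG, regDistSq_single_neg, h]
    · exact hp y h
  have hGpos : 0 < ∫ y, G 1 y := by
    obtain ⟨y, hy, hWy⟩ := hne
    have hc : Continuous (G 1) :=
      hW.mul ((continuous_regDistSq_rpow _ one_pos _).sub (continuous_regDistSq_rpow _ one_pos _))
    refine integral_pos_of_integrable_nonneg_nonzero (x := y) hc (hGint 1 one_pos) hnonneg ?_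
    refine mul_ne_zero hWy (sub_ne_zero.mpr fun he => hy ?_)
    have := (Real.rpow_left_inj (regDistSq_pos _ one_pos y).le (regDistSq_pos _ one_pos y).le
      (by linarith : -a ≠ 0)).mp he
    rw [regDistSq_single_neg] at this
    have h4 : t * y k = 0 := by linarith
    exact (mul_eq_zero.mp h4).resolve_left ht.ne'
  -- The lower bound is uniform in `ε ≤ 1`, so strict positivity survives the limit.
  have hle : (∫ y, G 1 y) / 2 ≤ L := by
    refine ge_of_tendsto hlim ?_
    filter_upwards [self_mem_nhdsWithin,
      mem_nhdsWithin_of_mem_nhds (Iic_mem_nhds (zero_lt_one' ℝ))] with ε hε hε1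
    have := integral_mono (hGint 1 one_pos) (hGint ε hε) (hmono ε hε hε1)
    rw [hGeq ε hε] at this
    linarith
  linarith

end Positivity

/-! ### Signs of the velocity on the axis and on the plane `z = 0`. -/

section BiotSavartSigns

variable {n : ℕ}

theorem rCoord_coordReflection (k : Fin (n + 1)) (y : EuclideanSpace ℝ (Fin (n + 1))) :
    rCoord (coordReflection k y) = rCoord y := by
  unfold rCoord
  congr 1
  refine Finset.sum_congr rfl fun i _ => ?_
  rw [coordReflection_apply]
  split_ifs <;> ring

theorem apply_castSucc_eq_zero {y : EuclideanSpace ℝ (Fin (n + 1))} (h : rCoord y = 0)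
    (i : Fin n) : y i.castSucc = 0 := by
  by_contra hy
  exact (rCoord_pos_of_ne_zero hy).ne' h

theorem continuous_vorticityEntry {d : ℕ}
    {u : EuclideanSpace ℝ (Fin d) → EuclideanSpace ℝ (Fin d)}
    (hc : ∀ j m, Continuous fun x => fderiv ℝ (fun y => u y j) x m) (i j : Fin d) :
    Continuous (vorticityEntry u i j) :=
  (hc j _).sub (hc i _)

variable {u : EuclideanSpace ℝ (Fin (n + 1)) → EuclideanSpace ℝ (Fin (n + 1))}
  {ur uz : ℝ → ℝ → ℝ}

/-- Oddness forces `ω(r, 0) = 0`. The condition `z ≠ 0` puts the point off the reflecting hyperplane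
in the axial case and makes `z ω` nonzero in the radial one. -/
theorem exists_mul_scalarVorticity_ne_zero
    (hodd : ∀ r z : ℝ, 0 < r → scalarVorticity ur uz r (-z) = -scalarVorticity ur uz r z)
    (hne : ∃ r z : ℝ, 0 < r ∧ scalarVorticity ur uz r z ≠ 0) :
    ∃ r z : ℝ, 0 < r ∧ z ≠ 0 ∧ scalarVorticity ur uz r z ≠ 0 := by
  obtain ⟨r, z, hr, h⟩ := hne
  refine ⟨r, z, hr, ?_, h⟩
  rintro rfl
  have := hodd r 0 hr
  rw [neg_zero] at this
  exact h (by linarith)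

theorem axial_velocity_neg (hn : 3 ≤ n + 1) (hcont : Continuous u) {C : ℝ}
    (hC : ∀ j x, |u x j| ≤ C) (hu : Differentiable ℝ u)
    (hu2 : ∀ j, MemLp (fun x => u x j) 2 volume)
    (hc : ∀ j m, Continuous fun x => fderiv ℝ (fun y => u y j) x m)
    (hu'2 : ∀ j m, MemLp (fun x => fderiv ℝ (fun y => u y j) x m) 2 volume)
    (hdiv : ∀ x, ∑ j, fderiv ℝ (fun y => u y j) x (EuclideanSpace.single j 1) = 0)
    (haxi : IsAxisymSwirlFree u ur uz)
    (hodd : ∀ r z : ℝ, 0 < r → scalarVorticity ur uz r (-z) = -scalarVorticity ur uz r z)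
    (hnonneg : ∀ r z : ℝ, 0 < r → 0 < z → 0 ≤ scalarVorticity ur uz r z)
    (hne : ∃ r z : ℝ, 0 < r ∧ scalarVorticity ur uz r z ≠ 0) {z₀ : ℝ} (hz₀ : 0 < z₀) :
    uz 0 z₀ < 0 := by
  set p : EuclideanSpace ℝ (Fin (n + 1)) := EuclideanSpace.single (Fin.last n) z₀ with hp
  set W : EuclideanSpace ℝ (Fin (n + 1)) → ℝ := fun y =>
    ∑ i : Fin n, y i.castSucc * vorticityEntry u i.castSucc (Fin.last n) y with hW
  have hWc : Continuous W := by
    refine continuous_finsetSum _ fun i _ => ?_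
    exact Continuous.mul (by fun_prop) (continuous_vorticityEntry hc _ _)
  -- The sum `Σ y_i² / r` equals `r`; on the axis both sides vanish, whatever value
  -- `scalarVorticity` takes there.
  have hWr : ∀ y, W y = rCoord y * scalarVorticity ur uz (rCoord y) (zCoord y) := fun y => by
    rcases (rCoord_nonneg y).eq_or_lt with h | h
    · simp only [hW, apply_castSucc_eq_zero h.symm, ← h, zero_mul, Finset.sum_const_zero]
    · have h1 : W y = (∑ i : Fin n, y i.castSucc ^ 2) *
          (scalarVorticity ur uz (rCoord y) (zCoord y) / rCoord y) := by
        rw [Finset.sum_mul]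
        refine Finset.sum_congr rfl fun i _ => ?_
        rw [haxi.vorticityEntry_castSucc_last hu h]
        ring
      rw [h1, ← rCoord_sq]
      field_simp
  -- The pole lies on the axis, so `(y - p)_i = y_i` for horizontal `i`, and the vertical term drops
  -- because the diagonal entry is zero.
  have hker : ∀ ε y, ∑ i, biotSavartKernel p ε i y * vorticityEntry u i (Fin.last n) y =
      W y * regDistSq p ε y ^ (-(((n + 1 : ℕ) : ℝ) / 2)) := fun ε y => by
    rw [Fin.sum_univ_castSucc, Finset.sum_mul]
    have h0 : vorticityEntry u (Fin.last n) (Fin.last n) y = 0 := sub_self _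
    rw [h0, mul_zero, add_zero]
    refine Finset.sum_congr rfl fun i _ => ?_
    have : (y - p) i.castSucc = y i.castSucc := by simp [hp]
    rw [biotSavartKernel, this, neg_div]
    ring
  have hlim := (tendsto_integral_mollifier p
    (g := fun y => u y (Fin.last n)) (by fun_prop) (hC _)).neg
  have hpos : 0 < -((∫ x : EuclideanSpace ℝ (Fin (n + 1)),
      ((n + 1 : ℕ) : ℝ) * (1 + ‖x‖ ^ 2) ^ (-((n + 1 : ℕ) : ℝ) / 2 - 1)) * u p (Fin.last n)) := by
    refine pos_of_tendsto_integral_odd (Fin.last n) hz₀ (a := ((n + 1 : ℕ) : ℝ) / 2)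
      (by positivity) hWc (fun y _ => ?_) (fun y hy => ?_) ?_ (fun ε hε => ?_)
      (hlim.congr' ?_)
    · rw [hWr, hWr, rCoord_coordReflection]
      have hz : zCoord (coordReflection (Fin.last n) y) = -zCoord y := by
        simp [zCoord, coordReflection_apply]
      rw [hz]
      rcases (rCoord_nonneg y).eq_or_lt with h | h
      · simp [← h]
      · rw [hodd _ _ h, mul_neg]
    · rw [hWr]
      rcases (rCoord_nonneg y).eq_or_lt with h | h
      · simp [← h]
      · exact mul_nonneg h.le (hnonneg _ _ h hy)
    · obtain ⟨r, z, hr, hz, hω⟩ := exists_mul_scalarVorticity_ne_zero hodd hne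
      refine ⟨halfPlanePoint ⟨0, by omega⟩ r z, ?_, ?_⟩
      · exact (zCoord_halfPlanePoint _ r z).trans_ne hz
      · rw [hWr, rCoord_halfPlanePoint _ hr.le, zCoord_halfPlanePoint]
        exact mul_ne_zero hr.ne' hω
    · rw [← hp]
      simp only [← hker]
      exact integrable_finsetSum _ fun i _ =>
        integrable_kernel_mul_vorticityEntry hn p hε hu'2 i _
    · filter_upwards [self_mem_nhdsWithin] with ε hε
      rw [← mollified_biotSavart hn p hε hu hu2 hu'2 hdiv (Fin.last n)]
      simp only [hker]
      rw [hp]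
  have hup : u p (Fin.last n) = uz 0 z₀ := by
    rw [haxi.apply_last]
    simp [hp, rCoord, zCoord]
  rw [hup] at hpos
  have hm := integral_mollifier_pos (by omega : 0 < n + 1)
  by_contra! h
  have := mul_nonneg hm.le h
  linarith

theorem radial_velocity_pos (hn : 3 ≤ n + 1) (hcont : Continuous u) {C : ℝ}
    (hC : ∀ j x, |u x j| ≤ C) (hu : Differentiable ℝ u)
    (hu2 : ∀ j, MemLp (fun x => u x j) 2 volume)
    (hc : ∀ j m, Continuous fun x => fderiv ℝ (fun y => u y j) x m)
    (hu'2 : ∀ j m, MemLp (fun x => fderiv ℝ (fun y => u y j) x m) 2 volume)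
    (hdiv : ∀ x, ∑ j, fderiv ℝ (fun y => u y j) x (EuclideanSpace.single j 1) = 0)
    (haxi : IsAxisymSwirlFree u ur uz)
    (hodd : ∀ r z : ℝ, 0 < r → scalarVorticity ur uz r (-z) = -scalarVorticity ur uz r z)
    (hnonneg : ∀ r z : ℝ, 0 < r → 0 < z → 0 ≤ scalarVorticity ur uz r z)
    (hne : ∃ r z : ℝ, 0 < r ∧ scalarVorticity ur uz r z ≠ 0) {r₀ : ℝ} (hr₀ : 0 < r₀) :
    0 < ur r₀ 0 := by
  set i₀ : Fin n := ⟨0, by omega⟩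
  set k : Fin (n + 1) := i₀.castSucc with hk
  set p : EuclideanSpace ℝ (Fin (n + 1)) := EuclideanSpace.single k r₀ with hp
  set W : EuclideanSpace ℝ (Fin (n + 1)) → ℝ := fun y =>
    zCoord y * vorticityEntry u k (Fin.last n) y with hW
  have hWc : Continuous W := by
    refine Continuous.mul ?_ (continuous_vorticityEntry hc _ _)
    unfold zCoord
    fun_prop
  have hWr : ∀ y, y k ≠ 0 → W y =
      zCoord y * scalarVorticity ur uz (rCoord y) (zCoord y) / rCoord y * y k := fun y hy => by
    simp only [hW]
    rw [hk, haxi.vorticityEntry_castSucc_last hu (rCoord_pos_of_ne_zero hy)]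
    ring
  -- The entry vanishes where `y_k ≠ 0`, which forces `r > 0`; continuity covers the rest.
  have hhor : ∀ (i : Fin n) y, vorticityEntry u i.castSucc k y = 0 := fun i => by
    have := (continuous_vorticityEntry hc i.castSucc k).ext_on (dense_coord_ne_zero k)
      (continuous_const (y := (0 : ℝ)))
      (fun y hy => haxi.vorticityEntry_castSucc_castSucc hu (rCoord_pos_of_ne_zero hy) i i₀)
    exact fun y => congrFun this y
  -- Only the vertical term survives, with `(y - p)_d = z`. Antisymmetry of the vorticity matrix
  -- produces the minus sign, which reverses the sign compared with the axial case.
  have hker : ∀ ε y, ∑ i, biotSavartKernel p ε i y * vorticityEntry u i k y =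
      -(W y * regDistSq p ε y ^ (-(((n + 1 : ℕ) : ℝ) / 2))) := fun ε y => by
    have h1 : (y - p) (Fin.last n) = zCoord y := by
      have : Fin.last n ≠ k := (Fin.castSucc_lt_last i₀).ne'
      simp [hp, zCoord, this]
    have h2 : vorticityEntry u (Fin.last n) k y = -vorticityEntry u k (Fin.last n) y := by
      simp [vorticityEntry]
    rw [Fin.sum_univ_castSucc]
    simp only [hhor, mul_zero, Finset.sum_const_zero, zero_add]
    rw [biotSavartKernel, h1, h2, neg_div]
    ring
  have hlim := tendsto_integral_mollifier p
    (g := fun y => u y k) (by fun_prop) (hC _)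
  have hpos : 0 < (∫ x : EuclideanSpace ℝ (Fin (n + 1)),
      ((n + 1 : ℕ) : ℝ) * (1 + ‖x‖ ^ 2) ^ (-((n + 1 : ℕ) : ℝ) / 2 - 1)) * u p k := by
    refine pos_of_tendsto_integral_odd k hr₀ (a := ((n + 1 : ℕ) : ℝ) / 2)
      (by positivity) hWc (fun y hy => ?_) (fun y hy => ?_) ?_ (fun ε hε => ?_)
      (hlim.congr' ?_)
    · have hRk : coordReflection k y k = -y k := by simp [coordReflection_apply]
      have hz : zCoord (coordReflection k y) = zCoord y := by
        have : Fin.last n ≠ k := (Fin.castSucc_lt_last i₀).ne'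
        simp [zCoord, coordReflection_apply, this]
      rw [hWr _ (by rw [hRk]; exact neg_ne_zero.mpr hy), hWr y hy, rCoord_coordReflection, hz, hRk]
      ring
    · have hr := rCoord_pos_of_ne_zero (i := i₀) hy.ne'
      rw [hWr y hy.ne']
      refine mul_nonneg (div_nonneg ?_ hr.le) hy.le
      -- Oddness in `z` makes `z ω ≥ 0` on both sides of `z = 0`.
      rcases lt_trichotomy (zCoord y) 0 with h | h | h
      · have h1 := hnonneg _ (-zCoord y) hr (by linarith)
        rw [hodd _ _ hr] at h1
        exact mul_nonneg_of_nonpos_of_nonpos h.le (by linarith)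
      · simp [h]
      · exact mul_nonneg h.le (hnonneg _ _ hr h)
    · obtain ⟨r, z, hr, hz, hω⟩ := exists_mul_scalarVorticity_ne_zero hodd hne
      have hyk : (halfPlanePoint i₀ r z) k = r := by simp [halfPlanePoint, hk]
      refine ⟨halfPlanePoint i₀ r z, by rw [hyk]; exact hr.ne', ?_⟩
      rw [hWr _ (by rw [hyk]; exact hr.ne'), rCoord_halfPlanePoint _ hr.le,
        zCoord_halfPlanePoint, hyk]
      exact mul_ne_zero (div_ne_zero (mul_ne_zero hz hω) hr.ne') hr.ne'
    · rw [← hp]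
      have : Integrable fun y => ∑ i, biotSavartKernel p ε i y * vorticityEntry u i k y :=
        integrable_finsetSum _ fun i _ =>
          integrable_kernel_mul_vorticityEntry hn p hε hu'2 i _
      simp only [hker] at this
      simpa using this.neg
    · filter_upwards [self_mem_nhdsWithin] with ε hε
      rw [← neg_inj, ← mollified_biotSavart hn p hε hu hu2 hu'2 hdiv k]
      simp only [hker, integral_neg]
      rw [hp]
  have hup : u p k = ur r₀ 0 := by
    have e : p = halfPlanePoint i₀ r₀ 0 := by simp [hp, hk, halfPlanePoint]
    rw [e, hk, haxi.apply_castSucc, rCoord_halfPlanePoint _ hr₀.le, zCoord_halfPlanePoint]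
    have : (halfPlanePoint i₀ r₀ 0) i₀.castSucc = r₀ := by simp [halfPlanePoint]
    rw [this, mul_assoc, inv_mul_cancel₀ hr₀.ne', mul_one]
  rw [hup] at hpos
  exact pos_of_mul_pos_right hpos (integral_mollifier_pos (by omega : 0 < n + 1)).le

end BiotSavartSigns

end AxisymFlow

end

theorem mainTheorem11 (n : ℕ) (hn : 3 ≤ n + 1) (s : ℝ) (hs : 1 + ((n + 1 : ℕ) : ℝ) / 2 < s)
    (u : EuclideanSpace ℝ (Fin (n + 1)) → EuclideanSpace ℝ (Fin (n + 1)))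
    (hcont : Continuous u) -- the continuous representative of the class in `H^s`
    (hu : AxisymFlow.MemHsDivFree s u)
    (ur uz : ℝ → ℝ → ℝ) (haxi : AxisymFlow.IsAxisymSwirlFree u ur uz)
    (hodd : ∀ r z : ℝ, 0 < r →
      AxisymFlow.scalarVorticity ur uz r (-z) = -AxisymFlow.scalarVorticity ur uz r z)
    (hnonneg : ∀ r z : ℝ, 0 < r → 0 < z → 0 ≤ AxisymFlow.scalarVorticity ur uz r z)
    (hne : ∃ r z : ℝ, 0 < r ∧ AxisymFlow.scalarVorticity ur uz r z ≠ 0) :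
    (∀ z : ℝ, 0 < z → uz 0 z < 0) ∧ (∀ r : ℝ, 0 < r → 0 < ur r 0) := by
  obtain ⟨⟨C, hC⟩, hd, hu2, hc, hu'2, hdiv⟩ :=
    AxisymFlow.regularity_of_memHsDivFree hs hcont hu
  exact ⟨fun z hz => AxisymFlow.axial_velocity_neg hn hcont hC hd hu2 hc hu'2 hdiv haxi hodd
      hnonneg hne hz,
    fun r hr => AxisymFlow.radial_velocity_pos hn hcont hC hd hu2 hc hu'2 hdiv haxi hodd
      hnonneg hne hr⟩
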